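/- Let $R$ be a Cohen–Macaulay local ring (commutative, Noetherian) possessing a canonical module $\omega_R$, i.e. a maximal Cohen–Macaulay $R$-module of type one and finite injective dimension. For an $R$-module $N$ write $N^{\vee}=\operatorname{Hom}_R(N,\omega_R)$. A finitely generated $R$-module $L$ is called maximal Cohen–Macaulay if $\operatorname{depth} L=\dim R$, with the convention $\operatorname{depth} 0=+\infty$ (so the zero module is not maximal Cohen–Macaulay). Let $M$ and $N$ be finitely generated $R$-modules such that $N$ and $M\otimes_R N^{\vee}$ are maximal Cohen–Macaulay. Then: (i) if $n\ge 1$ is an integer and $\operatorname{Tor}_j^R(M,N^{\vee})=0$ for all $j=1,\dots,n$, then $\operatorname{Ext}^j_R(M,N)=0$ for all $j=1,\dots,n$; (ii) if $M$ and $N^{\vee}$ are Tor-independent, i.e. $\operatorname{Tor}_j^R(M,N^{\vee})=0$ for all $j\ge 1$, then $\operatorname{Ext}^j_R(M,N)=0$ for all $j\ge 1$. -/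

import Mathlib

open CategoryTheory CategoryTheory.Abelian TensorProduct

universe u

namespace CohenMacaulay

noncomputable section

open Classical in
/-- The depth of a (finite) module `M` over a local ring `R` with maximal ideal `𝔪`: the supremum
of the lengths of the `M`-regular sequences in `𝔪`, with the convention `depth 0 = ∞`. -/
def depth (R : Type u) [CommRing R] [IsLocalRing R]
    (M : Type u) [AddCommGroup M] [Module R M] : ℕ∞ :=
  if Subsingleton M then ⊤
  else ⨆ rs : {rs : List R //
      (∀ r ∈ rs, r ∈ IsLocalRing.maximalIdeal R) ∧ RingTheory.Sequence.IsRegular M rs},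
    (rs.1.length : ℕ∞)

/-- A finite module `M` over a local ring `R` is maximal Cohen-Macaulay if
`depth M = dim R`. In particular the zero module over a Noetherian local ring is not. -/
structure IsMaximalCohenMacaulay (R : Type u) [CommRing R] [IsLocalRing R]
    (M : Type u) [AddCommGroup M] [Module R M] : Prop where
  finite : Module.Finite R M
  depth_eq : ((depth R M : ℕ∞) : WithBot ℕ∞) = ringKrullDim R

/-- A Cohen-Macaulay local ring: a Noetherian local ring `R` with `depth R = dim R`. -/
structure IsCohenMacaulayLocalRing (R : Type u) [CommRing R] [IsLocalRing R] : Prop where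
  noetherian : IsNoetherianRing R
  depth_eq : ((depth R R : ℕ∞) : WithBot ℕ∞) = ringKrullDim R

/-- The (Cohen-Macaulay) type of a nonzero finite module `M` of depth `t` over a Noetherian local
ring `R` with residue field `k`, i.e. `dim_k Ext^t_R(k, M)`. As `Ext^t_R(k, M)` is killed by the
maximal ideal, its dimension over `k` is its length over `R`. -/
def moduleType (R : Type u) [CommRing R] [IsLocalRing R]
    (M : Type u) [AddCommGroup M] [Module R M] : ℕ∞ :=
  Module.length R
    (Ext (ModuleCat.of R (IsLocalRing.ResidueField R)) (ModuleCat.of R M) (depth R M).toNat)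

/-- A canonical module of a Cohen-Macaulay local ring `R`: a maximal Cohen-Macaulay module of
type one and of finite injective dimension. -/
structure IsCanonicalModule (R : Type u) [CommRing R] [IsLocalRing R]
    (ω : Type u) [AddCommGroup ω] [Module R ω] : Prop where
  isMaximalCohenMacaulay : IsMaximalCohenMacaulay R ω
  type_eq_one : moduleType R ω = 1
  finite_injectiveDimension : ∃ d : ℕ, HasInjectiveDimensionLE (ModuleCat.of R ω) d

/-- The canonical dual `N^∨ = Hom_R(N, ω)`. -/
abbrev CanonicalDual (R : Type u) [CommRing R] (ω : Type u) [AddCommGroup ω] [Module R ω]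
    (N : Type u) [AddCommGroup N] [Module R N] : Type u :=
  N →ₗ[R] ω

/-- `Tor_j^R(M, N)`: the `j`-th homology of `P ⊗ N`, where `P` is a projective resolution of `M`. -/
abbrev TorModule (R : Type u) [CommRing R] (j : ℕ)
    (M : Type u) [AddCommGroup M] [Module R M] (N : Type u) [AddCommGroup N] [Module R N] :
    ModuleCat.{u} R :=
  ((Tor' (ModuleCat.{u} R) j).obj (ModuleCat.of R M)).obj (ModuleCat.of R N)

/-- `Ext^j_R(M, N)`. -/
abbrev ExtModule (R : Type u) [CommRing R] (j : ℕ)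
    (M : Type u) [AddCommGroup M] [Module R M] (N : Type u) [AddCommGroup N] [Module R N] :
    Type u :=
  Ext (ModuleCat.of R M) (ModuleCat.of R N) j

/-- `M` and `N` are Tor-independent if `Tor_j^R(M, N) = 0` for all `j ≥ 1`. -/
def TorIndependent (R : Type u) [CommRing R]
    (M : Type u) [AddCommGroup M] [Module R M] (N : Type u) [AddCommGroup N] [Module R N] : Prop :=
  ∀ j : ℕ, 1 ≤ j → Subsingleton (TorModule R j M N)

end

end CohenMacaulay

/-! Write `C = Hom(N, ω)` and let `P → M` be a projective resolution. If `N` is reflexive, `Hom(P,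
N) ≃ Hom(P, Hom(C, ω)) ≃ Hom(P ⊗ C, ω)`. The vanishing of Tor makes `P ⊗ C` exact in degrees `1, …,
n`, with `H₀ = M ⊗ C`. If its terms and `H₀` have no higher Ext into `ω`, then applying `Hom(-, ω)`
preserves this exactness, and so `Ext^j(M, N) = 0` in that range
(`subsingleton_ext_of_subsingleton_tor`).

Three facts about `ω` are needed. Higher Ext from maximal Cohen–Macaulay modules into `ω` vanishes
(`IsCanonicalModule.subsingleton_ext`), because finite injective dimension forces vanishing above
`dim R` and each regular element lowers this bound by one. The homotheties are all of `End(ω)`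
(`IsCanonicalModule.bijective_lsmul`): modulo a regular sequence this is a length count resting on
type one. Finally, `C` is again acyclic and `N` is reflexive (`subsingleton_ext_dual`,
`bijective_evaluation`), by passing to syzygies. -/

namespace CohenMacaulay

open RingTheory.Sequence

open scoped Pointwise

/-! ### Long exact sequences of Ext as vanishing criteria. -/

section ExtSequences

variable {R : Type u} [CommRing R]
  {A B C Y : Type u} [AddCommGroup A] [Module R A] [AddCommGroup B] [Module R B]
  [AddCommGroup C] [Module R C] [AddCommGroup Y] [Module R Y]

lemma shortExact_of_exact {f : A →ₗ[R] B} {g : B →ₗ[R] C} (hf : Function.Injective f)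
    (hfg : Function.Exact f g) (hg : Function.Surjective g) :
    (ModuleCat.shortComplexOfCompEqZero f g hfg.linearMap_comp_eq_zero).ShortExact :=
  ModuleCat.shortComplex_shortExact _ hfg hf hg

lemma subsingleton_ext_congr_left (e : A ≃ₗ[R] B) (i : ℕ) (h : Subsingleton (ExtModule R i A Y)) :
    Subsingleton (ExtModule R i B Y) := by
  refine subsingleton_of_forall_eq 0 fun x ↦ ?_
  have h1 : (Ext.mk₀ e.toModuleIso.inv).comp
      ((Ext.mk₀ e.toModuleIso.hom).comp x (zero_add i)) (zero_add i) = x := by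
    rw [Ext.mk₀_comp_mk₀_assoc, Iso.inv_hom_id, Ext.mk₀_id_comp]
  rw [← h1, Subsingleton.elim ((Ext.mk₀ e.toModuleIso.hom).comp x (zero_add i)) 0, Ext.comp_zero]

lemma subsingleton_ext_of_projective [Module.Projective R A] {i : ℕ} (hi : 1 ≤ i) :
    Subsingleton (ExtModule R i A Y) := by
  obtain ⟨j, rfl⟩ := Nat.exists_eq_add_of_le' hi
  have : Projective (ModuleCat.of R A) := (IsProjective.iff_projective A).mp inferInstance
  exact Ext.subsingleton_of_projective _ _ j

lemma subsingleton_ext_of_injective [Injective (ModuleCat.of R Y)] {i : ℕ} (hi : 1 ≤ i) :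
    Subsingleton (ExtModule R i A Y) := by
  obtain ⟨j, rfl⟩ := Nat.exists_eq_add_of_le' hi
  exact Ext.subsingleton_of_injective _ _ j

section

variable {f : A →ₗ[R] B} {g : B →ₗ[R] C}

lemma subsingleton_ext_middle (hf : Function.Injective f) (hfg : Function.Exact f g)
    (hg : Function.Surjective g) {i : ℕ} (hA : Subsingleton (ExtModule R i A Y))
    (hC : Subsingleton (ExtModule R i C Y)) : Subsingleton (ExtModule R i B Y) := by
  refine subsingleton_of_forall_eq 0 fun x ↦ ?_
  obtain ⟨y, rfl⟩ := Ext.contravariant_sequence_exact₂ (shortExact_of_exact hf hfg hg)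
    (ModuleCat.of R Y) x (hA.elim _ _)
  rw [show y = 0 from hC.elim _ _, Ext.comp_zero]

lemma subsingleton_ext_left (hf : Function.Injective f) (hfg : Function.Exact f g)
    (hg : Function.Surjective g) {i : ℕ} (hB : Subsingleton (ExtModule R i B Y))
    (hC : Subsingleton (ExtModule R (i + 1) C Y)) : Subsingleton (ExtModule R i A Y) := by
  refine subsingleton_of_forall_eq 0 fun x ↦ ?_
  obtain ⟨y, rfl⟩ := Ext.contravariant_sequence_exact₁ (shortExact_of_exact hf hfg hg)
    (ModuleCat.of R Y) x (add_comm 1 i) (hC.elim _ _)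
  rw [show y = 0 from hB.elim _ _, Ext.comp_zero]

/-- A homomorphism from a submodule extends if `Ext¹` of the quotient vanishes. -/
lemma exists_extension (hf : Function.Injective f) (hfg : Function.Exact f g)
    (hg : Function.Surjective g) (hC : Subsingleton (ExtModule R 1 C Y)) (φ : A →ₗ[R] Y) :
    ∃ ψ : B →ₗ[R] Y, ψ ∘ₗ f = φ := by
  obtain ⟨y, hy⟩ := Ext.contravariant_sequence_exact₁ (shortExact_of_exact hf hfg hg)
    (ModuleCat.of R Y) (Ext.mk₀ (ModuleCat.ofHom φ)) (add_zero 1) (hC.elim _ _)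
  obtain ⟨ψ, rfl⟩ := (Ext.mk₀_bijective _ _).2 y
  rw [Ext.mk₀_comp_mk₀] at hy
  refine ⟨ψ.hom, ?_⟩
  simpa using congrArg ModuleCat.Hom.hom ((Ext.mk₀_bijective _ _).1 hy)

end

section Covariant

variable {X : Type u} [AddCommGroup X] [Module R X] {f : A →ₗ[R] B} {g : B →ₗ[R] C}

lemma exists_lift (hf : Function.Injective f) (hfg : Function.Exact f g)
    (hg : Function.Surjective g) (hA : Subsingleton (ExtModule R 1 X A)) (φ : X →ₗ[R] C) :
    ∃ ψ : X →ₗ[R] B, g ∘ₗ ψ = φ := by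
  obtain ⟨y, hy⟩ := Ext.covariant_sequence_exact₃ (ModuleCat.of R X) (shortExact_of_exact hf hfg hg)
    (Ext.mk₀ (ModuleCat.ofHom φ)) (zero_add 1) (hA.elim _ _)
  obtain ⟨ψ, rfl⟩ := (Ext.mk₀_bijective _ _).2 y
  rw [Ext.mk₀_comp_mk₀] at hy
  refine ⟨ψ.hom, ?_⟩
  simpa using congrArg ModuleCat.Hom.hom ((Ext.mk₀_bijective _ _).1 hy)

lemma subsingleton_ext_one_of_lift (hf : Function.Injective f) (hfg : Function.Exact f g)
    (hg : Function.Surjective g) (hB : Subsingleton (ExtModule R 1 X B))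
    (hl : ∀ φ : X →ₗ[R] C, ∃ ψ : X →ₗ[R] B, g ∘ₗ ψ = φ) :
    Subsingleton (ExtModule R 1 X A) := by
  refine subsingleton_of_forall_eq 0 fun x ↦ ?_
  have hS := shortExact_of_exact hf hfg hg
  obtain ⟨y, rfl⟩ := Ext.covariant_sequence_exact₁ (ModuleCat.of R X) hS x (hB.elim _ _)
    (zero_add 1)
  obtain ⟨φ, rfl⟩ := (Ext.mk₀_bijective _ _).2 y
  obtain ⟨ψ, hψ⟩ := hl φ.hom
  have : φ = ModuleCat.ofHom ψ ≫
      (ModuleCat.shortComplexOfCompEqZero f g hfg.linearMap_comp_eq_zero).g := by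
    ext1
    simpa using hψ.symm
  rw [this, ← Ext.mk₀_comp_mk₀, Ext.comp_assoc _ _ _ (zero_add 0) (zero_add 1) (by simp),
    hS.comp_extClass, Ext.comp_zero]

lemma subsingleton_ext_succ_of_right (hf : Function.Injective f) (hfg : Function.Exact f g)
    (hg : Function.Surjective g) {i : ℕ} (hB : Subsingleton (ExtModule R (i + 1) X B))
    (hC : Subsingleton (ExtModule R i X C)) :
    Subsingleton (ExtModule R (i + 1) X A) := by
  refine subsingleton_of_forall_eq 0 fun x ↦ ?_
  obtain ⟨y, rfl⟩ := Ext.covariant_sequence_exact₁ (ModuleCat.of R X)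
    (shortExact_of_exact hf hfg hg) x (hB.elim _ _) rfl
  rw [show y = 0 from hC.elim _ _, Ext.zero_comp]

lemma subsingleton_ext_of_left (hf : Function.Injective f) (hfg : Function.Exact f g)
    (hg : Function.Surjective g) {i : ℕ} (hB : Subsingleton (ExtModule R i X B))
    (hA : Subsingleton (ExtModule R (i + 1) X A)) :
    Subsingleton (ExtModule R i X C) := by
  refine subsingleton_of_forall_eq 0 fun x ↦ ?_
  obtain ⟨y, rfl⟩ := Ext.covariant_sequence_exact₃ (ModuleCat.of R X)
    (shortExact_of_exact hf hfg hg) x rfl (hA.elim _ _)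
  rw [show y = 0 from hB.elim _ _, Ext.zero_comp]

lemma subsingleton_ext_covariant_middle (hf : Function.Injective f) (hfg : Function.Exact f g)
    (hg : Function.Surjective g) {i : ℕ} (hA : Subsingleton (ExtModule R i X A))
    (hC : Subsingleton (ExtModule R i X C)) : Subsingleton (ExtModule R i X B) := by
  refine subsingleton_of_forall_eq 0 fun x ↦ ?_
  obtain ⟨y, rfl⟩ := Ext.covariant_sequence_exact₂ (ModuleCat.of R X)
    (shortExact_of_exact hf hfg hg) x (hC.elim _ _)
  rw [show y = 0 from hA.elim _ _, Ext.zero_comp]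

end Covariant

/-- If `0 → A → A → C → 0` is exact, the first map being multiplication by an element of the
maximal ideal, then `Ext^{i+1}(C, Y) = 0` implies `Ext^i(A, Y) = 0`. -/
lemma subsingleton_ext_of_regular [IsLocalRing R] [IsNoetherianRing R] [Module.Finite R A]
    [Module.Finite R Y] {x : R} (hx : x ∈ IsLocalRing.maximalIdeal R) {g : A →ₗ[R] C}
    (hreg : IsSMulRegular A x) (hfg : Function.Exact (LinearMap.lsmul R A x) g)
    (hg : Function.Surjective g) {i : ℕ} (hC : Subsingleton (ExtModule R (i + 1) C Y)) :
    Subsingleton (ExtModule R i A Y) := by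
  have hS := shortExact_of_exact (f := LinearMap.lsmul R A x) hreg hfg hg
  rw [← Submodule.subsingleton_iff R, ← subsingleton_iff_bot_eq_top, eq_comm]
  -- Nakayama: `Ext^i(A, Y)` is finite over `R`, and exactness makes multiplication by `x`
  -- surjective on it.
  refine Submodule.eq_bot_of_le_smul_of_le_jacobson_bot (Ideal.span {x}) ⊤
    Module.Finite.fg_top ?_ ?_
  · intro y _
    obtain ⟨z, rfl⟩ := Ext.contravariant_sequence_exact₁ hS
      (ModuleCat.of R Y) y (add_comm 1 i) (hC.elim _ _)
    have : (ModuleCat.shortComplexOfCompEqZero (LinearMap.lsmul R A x) g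
        hfg.linearMap_comp_eq_zero).f = x • 𝟙 (ModuleCat.of R A) := rfl
    rw [this, Ext.mk₀_smul, Ext.smul_comp, Ext.mk₀_id_comp]
    exact Submodule.smul_mem_smul (Ideal.mem_span_singleton_self x) trivial
  · rw [IsLocalRing.jacobson_eq_maximalIdeal _ bot_ne_top]
    simpa [Ideal.span_le] using hx

end ExtSequences

/-! ### Depth and regular sequences. -/

section RegularSequences

variable {R : Type u} [CommRing R]

lemma isWeaklyRegular_of_prod_left {M N : Type u} [AddCommGroup M] [Module R M] [AddCommGroup N]
    [Module R N] {rs : List R} (h : IsWeaklyRegular (M × N) rs) : IsWeaklyRegular M rs := by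
  refine ⟨fun i hi ↦ ?_⟩
  set I := Ideal.ofList (rs.take i)
  let ι : (M ⧸ I • (⊤ : Submodule R M)) →ₗ[R] (M × N) ⧸ I • (⊤ : Submodule R (M × N)) :=
    Submodule.mapQ _ _ (LinearMap.inl R M N) (by
      rw [← Submodule.map_le_iff_le_comap, Submodule.map_smul'']
      exact Submodule.smul_mono le_rfl le_top)
  let π : (M × N) ⧸ I • (⊤ : Submodule R (M × N)) →ₗ[R] (M ⧸ I • (⊤ : Submodule R M)) :=
    Submodule.mapQ _ _ (LinearMap.fst R M N) (by
      rw [← Submodule.map_le_iff_le_comap, Submodule.map_smul'']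
      exact Submodule.smul_mono le_rfl le_top)
  have hπι : Function.LeftInverse π ι := by
    intro x
    obtain ⟨x, rfl⟩ := Submodule.mkQ_surjective _ x
    simp [π, ι]
  exact (h.regular_mod_prev i hi).of_injective ι hπι.injective

lemma isWeaklyRegular_of_prod_right {M N : Type u} [AddCommGroup M] [Module R M] [AddCommGroup N]
    [Module R N] {rs : List R} (h : IsWeaklyRegular (M × N) rs) : IsWeaklyRegular N rs :=
  isWeaklyRegular_of_prod_left
    (((LinearEquiv.prodComm R M N).isWeaklyRegular_congr rs).mp h)

variable [IsLocalRing R]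

lemma maximalIdeal_smul_top_lt {M : Type u} [AddCommGroup M] [Module R M]
    [Module.Finite R M] [Nontrivial M] :
    IsLocalRing.maximalIdeal R • (⊤ : Submodule R M) < ⊤ :=
  (Submodule.top_ne_ideal_smul_of_le_jacobson_annihilator
    (IsLocalRing.maximalIdeal_le_jacobson _)).symm.lt_top

lemma IsMaximalCohenMacaulay.nontrivial [IsNoetherianRing R] {M : Type u} [AddCommGroup M]
    [Module R M] (hM : IsMaximalCohenMacaulay R M) : Nontrivial M := by
  by_contra h
  rw [not_nontrivial_iff_subsingleton] at h
  have := hM.depth_eq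
  rw [depth, if_pos h] at this
  exact ringKrullDim_lt_top.ne this.symm

lemma IsMaximalCohenMacaulay.exists_isRegular [IsNoetherianRing R] {M : Type u} [AddCommGroup M]
    [Module R M] (hM : IsMaximalCohenMacaulay R M) {d : ℕ} (hd : ringKrullDim R = d) :
    ∃ rs : List R, rs.length = d ∧ (∀ r ∈ rs, r ∈ IsLocalRing.maximalIdeal R) ∧
      IsRegular M rs := by
  have := hM.nontrivial
  have h := hM.depth_eq
  have hd' : depth R M = d := by
    rw [hd] at h
    exact_mod_cast h
  rw [depth, if_neg (not_subsingleton M)] at hd'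
  have : Nonempty {rs : List R //
      (∀ r ∈ rs, r ∈ IsLocalRing.maximalIdeal R) ∧ IsRegular M rs} :=
    ⟨⟨[], by simp, IsRegular.nil R M⟩⟩
  -- A finite supremum over a nonempty index type is attained.
  obtain ⟨rs, hrs⟩ := ENat.exists_eq_iSup_of_lt_top (hd' ▸ ENat.natCast_lt_top d)
  exact ⟨rs.1, by exact_mod_cast hrs.trans hd', rs.2.1, rs.2.2⟩

lemma support_residueField :
    Module.support R (IsLocalRing.ResidueField R) =
      PrimeSpectrum.zeroLocus (IsLocalRing.maximalIdeal R) := by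
  rw [Module.support_eq_zeroLocus]
  congr 2
  exact Ideal.annihilator_quotient

lemma subsingleton_ext_residueField [IsNoetherianRing R] {M : Type u} [AddCommGroup M]
    [Module R M] [Module.Finite R M] [Nontrivial M] {rs : List R}
    (mem : ∀ r ∈ rs, r ∈ IsLocalRing.maximalIdeal R) (reg : IsRegular M rs) {i : ℕ}
    (hi : i < rs.length) :
    Subsingleton (ExtModule R i (IsLocalRing.ResidueField R) M) :=
  ModuleCat.subsingleton_ext_of_exists_isRegular (IsLocalRing.maximalIdeal R)
    (ModuleCat.of R (IsLocalRing.ResidueField R)) support_residueField.subset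
    (ModuleCat.of R M) maximalIdeal_smul_top_lt rs mem reg i hi

/-- By Rees, a regular sequence of given length exists as soon as `Ext^i(k, -)` vanishes below that
length. This condition passes to `M × N`, and a sequence regular there is regular on both factors.
-/
lemma exists_isRegular_common [IsNoetherianRing R] {M N : Type u} [AddCommGroup M]
    [Module R M] [Module.Finite R M] [Nontrivial M] [AddCommGroup N]
    [Module R N] [Module.Finite R N] [Nontrivial N] {rs rs' : List R}
    (mem : ∀ r ∈ rs, r ∈ IsLocalRing.maximalIdeal R) (reg : IsRegular M rs)
    (mem' : ∀ r ∈ rs', r ∈ IsLocalRing.maximalIdeal R) (reg' : IsRegular N rs')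
    (hlen : rs.length = rs'.length) :
    ∃ ts : List R, ts.length = rs.length ∧ (∀ r ∈ ts, r ∈ IsLocalRing.maximalIdeal R) ∧
      IsRegular M ts ∧ IsRegular N ts := by
  obtain ⟨ts, hl, hm, ht⟩ := ModuleCat.exists_isRegular_of_exists_subsingleton_ext
    (IsLocalRing.maximalIdeal R) rs.length (ModuleCat.of R (M × N))
    maximalIdeal_smul_top_lt (ModuleCat.of R (IsLocalRing.ResidueField R))
    support_residueField fun i hi ↦
      subsingleton_ext_covariant_middle LinearMap.inl_injective
        (Function.Exact.inl_snd) LinearMap.snd_surjective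
        (subsingleton_ext_residueField mem reg hi)
        (subsingleton_ext_residueField mem' reg' (hlen ▸ hi))
  exact ⟨ts, hl, hm,
    ((IsLocalRing.isRegular_iff_isWeaklyRegular_of_subset_maximalIdeal hm).mpr
      (isWeaklyRegular_of_prod_left ht.toIsWeaklyRegular)),
    ((IsLocalRing.isRegular_iff_isWeaklyRegular_of_subset_maximalIdeal hm).mpr
      (isWeaklyRegular_of_prod_right ht.toIsWeaklyRegular))⟩

end RegularSequences

/-! ### Ext into modules of finite injective dimension. -/

section InjectiveDimension

variable {R : Type u} [CommRing R] [IsLocalRing R]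

lemma nonempty_residueField_linearEquiv (M : Type u) [AddCommGroup M] [Module R M]
    [IsSimpleModule R M] : Nonempty (IsLocalRing.ResidueField R ≃ₗ[R] M) := by
  obtain ⟨I, hI, ⟨e⟩⟩ := isSimpleModule_iff_quot_maximal.mp ‹IsSimpleModule R M›
  obtain rfl := IsLocalRing.eq_maximalIdeal hI
  exact ⟨e.symm⟩

lemma exists_injective_residueField {M : Type u} [AddCommGroup M] [Module R M] [Nontrivial M]
    (hM : IsFiniteLength R M) :
    ∃ f : IsLocalRing.ResidueField R →ₗ[R] M, Function.Injective f := by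
  have := (isFiniteLength_iff_isNoetherian_isArtinian.mp hM).2
  obtain ⟨N, hN, -⟩ := (IsAtomic.eq_bot_or_exists_atom_le (⊤ : Submodule R M)).resolve_left
    top_ne_bot
  have : IsSimpleModule R N := isSimpleModule_iff_isAtom.mpr hN
  obtain ⟨e⟩ := nonempty_residueField_linearEquiv (R := R) N
  exact ⟨N.subtype ∘ₗ e.toLinearMap, N.subtype_injective.comp e.injective⟩

lemma isFiniteLength_quotient_of_isRegular [IsNoetherianRing R] {rs : List R}
    (reg : IsRegular R rs) (hd : ringKrullDim R = rs.length) :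
    IsFiniteLength R (R ⧸ Ideal.ofList rs) := by
  have h := ringKrullDim_add_length_eq_ringKrullDim_of_isRegular rs reg
  rw [hd] at h
  have h0 : ringKrullDim (R ⧸ Ideal.ofList rs) = 0 :=
    (ENat.WithBot.add_natCast_cancel (c := rs.length)).mp (by rw [h, zero_add])
  have : Ring.KrullDimLE 0 (R ⧸ Ideal.ofList rs) := by
    rw [Ring.krullDimLE_iff, h0]; rfl
  have : IsArtinianRing (R ⧸ Ideal.ofList rs) :=
    isArtinianRing_iff_isNoetherianRing_krullDimLE_zero.mpr ⟨inferInstance, this⟩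
  refine isFiniteLength_iff_isNoetherian_isArtinian.mpr ⟨inferInstance, ?_⟩
  exact isArtinian_of_surjective_algebraMap (R := R ⧸ Ideal.ofList rs) (S := R)
    Ideal.Quotient.mk_surjective

/-- Over a Noetherian local ring with a regular sequence `rs` such that `R ⧸ (rs)` has finite
length, the groups `Ext^i(X, Y)` with `Y` of finite injective dimension vanish in degrees
above the length of `rs`. -/
theorem subsingleton_ext_of_length_lt [IsNoetherianRing R] {rs : List R}
    (mem : ∀ r ∈ rs, r ∈ IsLocalRing.maximalIdeal R) (reg : IsRegular R rs)
    (hfin : IsFiniteLength R (R ⧸ Ideal.ofList rs)) {Y : Type u} [AddCommGroup Y] [Module R Y]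
    [Module.Finite R Y] (hY : ∃ D : ℕ, HasInjectiveDimensionLE (ModuleCat.of R Y) D)
    {X : Type u} [AddCommGroup X] [Module R X] [Module.Finite R X] {i : ℕ} (hi : rs.length < i) :
    Subsingleton (ExtModule R i X Y) := by
  obtain ⟨D, hD⟩ := hY
  -- Descending induction on `i`, starting above the injective dimension; `n` measures the distance
  -- to `D`.
  obtain ⟨n, hn⟩ : ∃ n, D < i + n := ⟨D + 1, by omega⟩
  induction n generalizing i X with
  | zero => exact HasInjectiveDimensionLT.subsingleton (ModuleCat.of R Y) (D + 1) i (by omega) _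
  | succ n ih =>
    have hsucc (Z : Type u) [AddCommGroup Z] [Module R Z] [Module.Finite R Z] :
      Subsingleton (ExtModule R (i + 1) Z Y) := ih (by omega) (by omega)
    -- The residue field `k` embeds in the socle of `R ⧸ (rs)`, whose projective dimension is
    -- `rs.length < i`; the cokernel is handled by degree `i + 1`.
    have hk : Subsingleton (ExtModule R i (IsLocalRing.ResidueField R) Y) := by
      have : Nontrivial (R ⧸ Ideal.ofList rs) :=
        Ideal.Quotient.nontrivial_iff.mpr (by simpa using reg.2.symm)
      obtain ⟨f, hf⟩ := exists_injective_residueField hfin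
      refine subsingleton_ext_left hf f.exact_map_mkQ_range (Submodule.mkQ_surjective _) ?_
        (hsucc _)
      have hpd := ModuleCat.projectiveDimension_quotient_eq_add_length_of_isWeaklyRegular
        (ModuleCat.of R R) rs reg.toIsWeaklyRegular mem
      rw [ModuleCat.projectiveDimension_eq_zero_of_projective (ModuleCat.of R R), zero_add] at hpd
      have := (projectiveDimension_le_iff _ _).mp hpd.le
      exact subsingleton_ext_congr_left (Submodule.quotEquivOfEq _ _ (by simp)) i
        (HasProjectiveDimensionLT.subsingleton (ModuleCat.of R (R ⧸ Ideal.ofList rs • ⊤))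
          (rs.length + 1) i (by omega) (ModuleCat.of R Y))
    -- A prime filtration reduces to `R ⧸ p`. For `p` not maximal, an element of the maximal ideal
    -- outside `p` is regular on `R ⧸ p`, which again passes to degree `i + 1`.
    induction ‹Module.Finite R X› using
      IsNoetherianRing.induction_on_isQuotientEquivQuotientPrime with
    | subsingleton N =>
      have : Module.Projective R N := Module.Projective.of_free
      exact subsingleton_ext_of_projective (by omega)
    | quotient N p e =>
      refine subsingleton_ext_congr_left e.symm i ?_
      by_cases hp : p.1 = IsLocalRing.maximalIdeal R
      · rw [hp]
        exact hk
      · obtain ⟨x, hx, hxp⟩ := SetLike.exists_of_lt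
          ((IsLocalRing.le_maximalIdeal p.2.ne_top).lt_of_ne hp)
        refine subsingleton_ext_of_regular hx ?_ (LinearMap.exact_map_mkQ_range _)
          (Submodule.mkQ_surjective _) (hsucc _)
        rw [isSMulRegular_iff_right_eq_zero_of_smul]
        intro y hy
        rw [Algebra.smul_def, mul_eq_zero] at hy
        exact hy.resolve_left (by simpa [Ideal.Quotient.eq_zero_iff_mem] using hxp)
    | exact N₁ N₂ N₃ f g hf hg hfg h₁ h₃ =>
      exact subsingleton_ext_middle hf hfg hg h₁ h₃

/-- If `Ext^i(-, Y)` vanishes on finite modules for all `i > d`, then `Ext^i(X, Y) = 0` for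
`i > 0` whenever `X` admits a regular sequence of length `d`. -/
theorem subsingleton_ext_of_isWeaklyRegular [IsNoetherianRing R] {Y : Type u} [AddCommGroup Y]
    [Module R Y] [Module.Finite R Y] {X : Type u} [AddCommGroup X] [Module R X]
    [Module.Finite R X] {rs : List R} (mem : ∀ r ∈ rs, r ∈ IsLocalRing.maximalIdeal R)
    (reg : IsWeaklyRegular X rs) {d : ℕ}
    (hd : ∀ (Z : Type u) [AddCommGroup Z] [Module R Z] [Module.Finite R Z] (i : ℕ),
      d < i → Subsingleton (ExtModule R i Z Y)) {i : ℕ} (hi : d < i + rs.length) :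
    Subsingleton (ExtModule R i X Y) := by
  induction rs generalizing X i with
  | nil => exact hd X i (by simpa using hi)
  | cons x rs ih =>
    rw [isWeaklyRegular_cons_iff] at reg
    simp only [List.mem_cons, forall_eq_or_imp] at mem
    exact subsingleton_ext_of_regular mem.1 reg.1 (LinearMap.exact_lsmul_mkQ_smul_top X x)
      (Submodule.mkQ_surjective _)
      (ih (X := QuotSMulTop x X) mem.2 reg.2 (by simp only [List.length_cons] at hi; omega))

end InjectiveDimension

/-! ### Lengths of Ext modules in the degree of the depth. -/

section Length

variable {R : Type u} [CommRing R]

lemma length_ext_congr_left {A B Y : Type u} [AddCommGroup A] [Module R A] [AddCommGroup B]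
    [Module R B] [AddCommGroup Y] [Module R Y] (e : A ≃ₗ[R] B) (i : ℕ) :
    Module.length R (ExtModule R i A Y) = Module.length R (ExtModule R i B Y) := by
  have h1 : Function.LeftInverse
      ((Ext.mk₀ e.toModuleIso.hom).precompOfLinear R (ModuleCat.of R Y) (zero_add i))
      ((Ext.mk₀ e.toModuleIso.inv).precompOfLinear R (ModuleCat.of R Y) (zero_add i)) := by
    intro x
    simp only [Ext.bilinearCompOfLinear_apply_apply]
    rw [Ext.mk₀_comp_mk₀_assoc, Iso.hom_inv_id, Ext.mk₀_id_comp]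
  have h2 : Function.RightInverse
      ((Ext.mk₀ e.toModuleIso.hom).precompOfLinear R (ModuleCat.of R Y) (zero_add i))
      ((Ext.mk₀ e.toModuleIso.inv).precompOfLinear R (ModuleCat.of R Y) (zero_add i)) := by
    intro x
    simp only [Ext.bilinearCompOfLinear_apply_apply]
    rw [Ext.mk₀_comp_mk₀_assoc, Iso.inv_hom_id, Ext.mk₀_id_comp]
  exact (LinearEquiv.ofBijective
    ((Ext.mk₀ e.toModuleIso.inv).precompOfLinear R (ModuleCat.of R Y) (zero_add i))
    ⟨h1.injective, h2.surjective⟩).length_eq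

/-- The condition `j + 1 = i` is void for `i = 0`, where left exactness of `Hom` suffices; otherwise
the connecting map has zero source. -/
lemma eq_zero_of_precomp_eq_zero {A B C Y : Type u} [AddCommGroup A] [Module R A]
    [AddCommGroup B] [Module R B] [AddCommGroup C] [Module R C] [AddCommGroup Y] [Module R Y]
    {f : A →ₗ[R] B} {g : B →ₗ[R] C} (hf : Function.Injective f) (hfg : Function.Exact f g)
    (hg : Function.Surjective g) {i : ℕ} (hA : ∀ j, j + 1 = i → Subsingleton (ExtModule R j A Y))
    (x : ExtModule R i C Y) (hx : (Ext.mk₀ (ModuleCat.ofHom g)).comp x (zero_add i) = 0) :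
    x = 0 := by
  have hS := shortExact_of_exact hf hfg hg
  cases i with
  | zero =>
    have : Epi (ModuleCat.ofHom g) := (ModuleCat.epi_iff_surjective _).mpr hg
    exact Ext.precomp_mk₀_injective_of_epi (ModuleCat.of R Y) (ModuleCat.ofHom g)
      (hx.trans (Ext.comp_zero _ _ _ _ (zero_add 0)).symm)
  | succ j =>
    obtain ⟨y, rfl⟩ := Ext.contravariant_sequence_exact₃ hS (ModuleCat.of R Y) x hx
      (add_comm 1 j)
    rw [show y = 0 from (hA j rfl).elim _ _, Ext.comp_zero]

lemma subsingleton_ext_of_subsingleton {A Y : Type u} [AddCommGroup A] [Module R A]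
    [AddCommGroup Y] [Module R Y] [Subsingleton A] (i : ℕ) :
    Subsingleton (ExtModule R i A Y) := by
  refine subsingleton_of_forall_eq 0 fun x ↦ ?_
  rw [← Ext.mk₀_id_comp x, ((ModuleCat.isZero_of_subsingleton (ModuleCat.of R A)).eq_of_src
    (𝟙 _) 0), Ext.mk₀_zero, Ext.zero_comp]

variable [IsLocalRing R] [IsNoetherianRing R]

lemma subsingleton_ext_of_isFiniteLength {W : Type u} [AddCommGroup W] [Module R W]
    [Module.Finite R W] [Nontrivial W] {rs : List R}
    (mem : ∀ r ∈ rs, r ∈ IsLocalRing.maximalIdeal R) (reg : IsRegular W rs)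
    {L : Type u} [AddCommGroup L] [Module R L] (hL : IsFiniteLength R L) {i : ℕ}
    (hi : i < rs.length) : Subsingleton (ExtModule R i L W) := by
  induction hL with
  | of_subsingleton => exact subsingleton_ext_of_subsingleton i
  | @of_simple_quotient M _ _ N _ hN ih =>
    obtain ⟨e⟩ := nonempty_residueField_linearEquiv (R := R) (M ⧸ N)
    exact subsingleton_ext_middle N.subtype_injective (LinearMap.exact_subtype_mkQ N)
      N.mkQ_surjective ih
      (subsingleton_ext_congr_left e i (subsingleton_ext_residueField mem reg hi))

/-- If `W` has a regular sequence of length `d`, if `Ext^d(k, W)` has length one and if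
`Ext^{d+1}(-, W)` vanishes, then `Ext^d(-, W)` preserves lengths. -/
lemma length_ext_eq_length {W : Type u} [AddCommGroup W] [Module R W] [Module.Finite R W]
    [Nontrivial W] {rs : List R} (mem : ∀ r ∈ rs, r ∈ IsLocalRing.maximalIdeal R)
    (reg : IsRegular W rs)
    (hk : Module.length R (ExtModule R rs.length (IsLocalRing.ResidueField R) W) = 1)
    (hvan : ∀ (Z : Type u) [AddCommGroup Z] [Module R Z] [Module.Finite R Z] (i : ℕ),
      rs.length < i → Subsingleton (ExtModule R i Z W))
    {L : Type u} [AddCommGroup L] [Module R L] (hL : IsFiniteLength R L) :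
    Module.length R (ExtModule R rs.length L W) = Module.length R L := by
  induction hL with
  | @of_subsingleton M =>
    have h1 := subsingleton_ext_of_subsingleton (R := R) (A := M) (Y := W) rs.length
    rw [Module.length_eq_zero_iff.mpr h1, Module.length_eq_zero_iff.mpr inferInstance]
  | @of_simple_quotient M _ _ N _ hN ih =>
    have := (isFiniteLength_iff_isNoetherian_isArtinian.mp hN).1
    have hfg : Function.Exact N.subtype N.mkQ := LinearMap.exact_subtype_mkQ N
    have hS := shortExact_of_exact N.subtype_injective hfg N.mkQ_surjective
    obtain ⟨e⟩ := nonempty_residueField_linearEquiv (R := R) (M ⧸ N)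
    have hq : Module.length R (ExtModule R rs.length (M ⧸ N) W) = 1 := by
      rw [← length_ext_congr_left e, hk]
    have hvq := hvan (M ⧸ N) (rs.length + 1) (Nat.lt_succ_self _)
    have hM1 : Module.length R (M ⧸ N) = 1 := Module.length_eq_one R _
    rw [Module.length_eq_add_of_exact N.subtype N.mkQ N.subtype_injective N.mkQ_surjective hfg,
      ← ih, hM1, add_comm, ← hq]
    -- The sequence `0 → Ext^d(M ⧸ N, W) → Ext^d(M, W) → Ext^d(N, W) → 0` is exact on the left since
    -- `Ext^{d-1}(N, W) = 0` (if `d > 0`), and on the right since `Ext^{d+1}(M ⧸ N, W) = 0`.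
    refine Module.length_eq_add_of_exact
      ((Ext.mk₀ (ModuleCat.ofHom N.mkQ)).precompOfLinear R (ModuleCat.of R W)
        (zero_add rs.length))
      ((Ext.mk₀ (ModuleCat.ofHom N.subtype)).precompOfLinear R (ModuleCat.of R W)
        (zero_add rs.length)) ?_ ?_ ?_
    · rw [injective_iff_map_eq_zero]
      exact fun x hx ↦ eq_zero_of_precomp_eq_zero N.subtype_injective hfg N.mkQ_surjective
        (fun j hj ↦ subsingleton_ext_of_isFiniteLength mem reg hN (by omega)) x hx
    · intro x
      obtain ⟨y, hy⟩ := Ext.contravariant_sequence_exact₁ hS (ModuleCat.of R W) x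
        (add_comm 1 _) (hvq.elim _ _)
      exact ⟨y, hy⟩
    · intro x
      constructor
      · intro hx
        obtain ⟨y, hy⟩ := Ext.contravariant_sequence_exact₂ hS (ModuleCat.of R W) x hx
        exact ⟨y, hy⟩
      · rintro ⟨y, rfl⟩
        simp only [Ext.bilinearCompOfLinear_apply_apply]
        rw [Ext.mk₀_comp_mk₀_assoc]
        rw [show ModuleCat.ofHom N.subtype ≫ ModuleCat.ofHom N.mkQ = 0 from
          (ModuleCat.shortComplexOfCompEqZero _ _ hfg.linearMap_comp_eq_zero).zero, Ext.mk₀_zero,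
          Ext.zero_comp]

/-- If the `W`-regular sequence `rs` kills `L`, then `Hom(L, W ⧸ (rs)W) ≃ Ext^d(L, W)` where `d`
is the length of `rs`. -/
lemma nonempty_hom_linearEquiv_ext {W : Type u} [AddCommGroup W] [Module R W]
    [Module.Finite R W] [Nontrivial W] {rs : List R}
    (mem : ∀ r ∈ rs, r ∈ IsLocalRing.maximalIdeal R) (reg : IsRegular W rs)
    {L : Type u} [AddCommGroup L] [Module R L] (hL : IsFiniteLength R L)
    (hann : ∀ r ∈ rs, r ∈ Module.annihilator R L) :
    Nonempty ((L →ₗ[R] W ⧸ Ideal.ofList rs • (⊤ : Submodule R W)) ≃ₗ[R]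
      ExtModule R rs.length L W) := by
  induction rs generalizing W with
  | nil =>
    let e : (W ⧸ Ideal.ofList ([] : List R) • (⊤ : Submodule R W)) ≃ₗ[R] W :=
      Submodule.quotEquivOfEqBot _ (by simp)
    exact ⟨(LinearEquiv.congrRight e).trans
      ((ModuleCat.homLinearEquiv (S := R) (M := ModuleCat.of R L) (N := ModuleCat.of R W)).symm.trans
      (Ext.linearEquiv₀ (R := R)).symm)⟩
  | cons x rs ih =>
    have hi (i : ℕ) (hi : i < (x :: rs).length) := subsingleton_ext_of_isFiniteLength mem reg hL hi
    rw [isRegular_cons_iff] at reg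
    simp only [List.mem_cons, forall_eq_or_imp] at mem hann
    have := nontrivial_quotSMulTop_of_mem_maximalIdeal (L := W) mem.1
    obtain ⟨e⟩ := ih (W := QuotSMulTop x W) mem.2 reg.2 hann.2
    have hS := reg.1.smulShortComplex_shortExact (M := ModuleCat.of R W)
    let δ : ExtModule R rs.length L (QuotSMulTop x W) →ₗ[R] ExtModule R (rs.length + 1) L W :=
      hS.extClass.postcompOfLinear R (ModuleCat.of R L) rfl
    -- Injectivity: Ext of `L` into `W` vanishes in degree `rs.length`, below the depth.
    -- Surjectivity: `x` kills `L`, hence acts as zero on Ext.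
    have hδ : Function.Bijective δ := by
      constructor
      · rw [injective_iff_map_eq_zero]
        intro y hy
        obtain ⟨z, rfl⟩ := Ext.covariant_sequence_exact₃ (ModuleCat.of R L) hS y rfl hy
        rw [show z = 0 from (hi _ (Nat.lt_succ_self _)).elim _ _, Ext.zero_comp]
        rfl
      · intro y
        have h0 : x • 𝟙 (ModuleCat.of R L) = 0 := by
          ext l
          exact Module.mem_annihilator.mp hann.1 l
        have hy : y.comp (Ext.mk₀ (x • 𝟙 (ModuleCat.of R W))) (add_zero _) = 0 := by
          rw [Ext.mk₀_smul, Ext.comp_smul, Ext.comp_mk₀_id, ← Ext.mk₀_id_comp y, ← Ext.smul_comp,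
            ← Ext.mk₀_smul, h0, Ext.mk₀_zero, Ext.zero_comp]
        obtain ⟨z, hz⟩ := Ext.covariant_sequence_exact₁ (ModuleCat.of R L) hS y hy rfl
        exact ⟨z, hz⟩
    exact ⟨(LinearEquiv.congrRight
      (Submodule.quotOfListConsSMulTopEquivQuotSMulTopInner W x rs)).trans
      (e.trans (LinearEquiv.ofBijective δ hδ))⟩

end Length

/-! ### Endomorphisms modulo a regular sequence. -/

section Endomorphisms

section

variable {R : Type u} [CommRing R] {A B : Type u} [AddCommGroup A] [Module R A]
  [AddCommGroup B] [Module R B]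

lemma injective_of_surjective_of_length_eq (f : A →ₗ[R] B) (hf : Function.Surjective f)
    (hA : Module.length R A ≠ ⊤) (h : Module.length R A = Module.length R B) :
    Function.Injective f := by
  have h1 := Module.length_eq_add_of_exact f.ker.subtype f f.ker.subtype_injective hf
    f.exact_subtype_ker_map
  rw [← h] at h1
  have h2 : Module.length R f.ker = 0 := by
    generalize Module.length R A = a at *
    generalize Module.length R f.ker = b at *
    lift a to ℕ using hA
    cases b
    · simp at h1
    · norm_cast at h1 ⊢
      omega
  rw [Module.length_eq_zero_iff, Submodule.subsingleton_iff_eq_bot] at h2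
  exact LinearMap.ker_eq_bot.mp h2

lemma surjective_of_injective_of_length_eq (f : A →ₗ[R] B) (hf : Function.Injective f)
    (hA : Module.length R A ≠ ⊤) (h : Module.length R A = Module.length R B) :
    Function.Surjective f := by
  have h1 := Module.length_eq_add_of_exact f f.range.mkQ hf (Submodule.mkQ_surjective _)
    f.exact_map_mkQ_range
  rw [← h] at h1
  have h2 : Module.length R (B ⧸ f.range) = 0 := by
    generalize Module.length R A = a at *
    generalize Module.length R (B ⧸ f.range) = b at *
    lift a to ℕ using hA
    cases b
    · simp at h1
    · norm_cast at h1 ⊢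
      omega
  rw [Module.length_eq_zero_iff, Submodule.Quotient.subsingleton_iff] at h2
  exact LinearMap.range_eq_top.mp h2

end

variable {R : Type u} [CommRing R] [IsLocalRing R] [IsNoetherianRing R]

/-- If `a = j + b x` kills `W`, then so does `b x`, hence `b` by regularity of `x`. Thus `Ann W ≤ J
+ x Ann W`, and Nakayama applies. The ideal `J` is arbitrary because the induction enlarges it by
`x`. -/
lemma annihilator_le_of_isWeaklyRegular {W : Type u} [AddCommGroup W] [Module R W]
    {rs : List R} (mem : ∀ r ∈ rs, r ∈ IsLocalRing.maximalIdeal R) (reg : IsWeaklyRegular W rs)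
    {J : Ideal R} (hJ : J ≤ Module.annihilator R W)
    (h : Module.annihilator R (W ⧸ Ideal.ofList rs • (⊤ : Submodule R W)) ≤ J ⊔ Ideal.ofList rs) :
    Module.annihilator R W ≤ J := by
  induction rs generalizing W J with
  | nil =>
    let e : (W ⧸ Ideal.ofList ([] : List R) • (⊤ : Submodule R W)) ≃ₗ[R] W :=
      Submodule.quotEquivOfEqBot _ (by simp)
    simpa [e.annihilator_eq] using h
  | cons x rs ih =>
    rw [isWeaklyRegular_cons_iff] at reg
    simp only [List.mem_cons, forall_eq_or_imp] at mem
    have h1 : Module.annihilator R (QuotSMulTop x W) ≤ J ⊔ Ideal.span {x} := by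
      refine ih mem.2 reg.2 (sup_le (hJ.trans ?_) ?_) ?_
      · exact LinearMap.annihilator_le_of_surjective _ (Submodule.mkQ_surjective _)
      · rw [Ideal.span_singleton_le_iff_mem]
        exact QuotSMulTop.mem_annihilator W x
      · rw [← (Submodule.quotOfListConsSMulTopEquivQuotSMulTopInner W x rs).annihilator_eq,
          sup_assoc, ← Ideal.ofList_cons]
        exact h
    refine Submodule.le_of_le_smul_of_le_jacobson_bot (I := Ideal.span {x})
      (IsNoetherian.noetherian _) ?_ ?_
    · rw [IsLocalRing.jacobson_eq_maximalIdeal _ bot_ne_top]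
      simpa [Ideal.span_le] using mem.1
    · intro a ha
      obtain ⟨j, hj, t, ht, rfl⟩ := Submodule.mem_sup.mp
        (h1 (LinearMap.annihilator_le_of_surjective _ (Submodule.mkQ_surjective _) ha))
      obtain ⟨b, rfl⟩ := Ideal.mem_span_singleton'.mp ht
      refine Submodule.add_mem_sup hj ?_
      rw [mul_comm]
      refine Submodule.smul_mem_smul (Ideal.mem_span_singleton_self x) ?_
      rw [Module.mem_annihilator] at ha ⊢
      intro w
      apply reg.1
      have := ha w
      rw [add_smul, Module.mem_annihilator.mp (hJ hj) w, zero_add, mul_comm, mul_smul] at this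
      simpa using this

lemma exists_smul_eq_of_isWeaklyRegular {W : Type u} [AddCommGroup W] [Module R W]
    [Module.Finite R W] {rs : List R} (mem : ∀ r ∈ rs, r ∈ IsLocalRing.maximalIdeal R)
    (reg : IsWeaklyRegular W rs)
    (h : ∀ φ : (W ⧸ Ideal.ofList rs • (⊤ : Submodule R W)) →ₗ[R]
      (W ⧸ Ideal.ofList rs • (⊤ : Submodule R W)), ∃ r : R, φ = r • LinearMap.id)
    (φ : W →ₗ[R] W) : ∃ r : R, φ = r • LinearMap.id := by
  induction rs generalizing W with
  | nil =>
    let e : (W ⧸ Ideal.ofList ([] : List R) • (⊤ : Submodule R W)) ≃ₗ[R] W :=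
      Submodule.quotEquivOfEqBot _ (by simp)
    obtain ⟨r, hr⟩ := h (e.symm.conj φ)
    refine ⟨r, ?_⟩
    rw [← e.conj_conj_symm φ, hr]
    ext w
    simp [LinearEquiv.conj_apply]
  | cons x rs ih =>
    rw [isWeaklyRegular_cons_iff] at reg
    simp only [List.mem_cons, forall_eq_or_imp] at mem
    have h1 (ψ : QuotSMulTop x W →ₗ[R] QuotSMulTop x W) : ∃ r : R, ψ = r • LinearMap.id := by
      refine ih mem.2 reg.2 (fun χ ↦ ?_) ψ
      let e := Submodule.quotOfListConsSMulTopEquivQuotSMulTopInner W x rs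
      obtain ⟨r, hr⟩ := h (e.symm.conj χ)
      refine ⟨r, ?_⟩
      rw [← e.conj_conj_symm χ, hr]
      ext w
      simp [LinearEquiv.conj_apply]
    -- If `ψ` is the homothety `r` modulo `x`, then `ψ - r` is divisible by `x`, and the quotient is
    -- linear as `x` is regular. Nakayama then applies to `End(W)`.
    have hsup : (⊤ : Submodule R (W →ₗ[R] W)) ≤
        Submodule.span R {LinearMap.id} ⊔ Ideal.span {x} • (⊤ : Submodule R (W →ₗ[R] W)) := by
      intro ψ _
      obtain ⟨r, hr⟩ := h1 (QuotSMulTop.map x ψ)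
      have hdiv (w : W) : ∃ v : W, x • v = ψ w - r • w := by
        have := LinearMap.congr_fun hr (Submodule.mkQ _ w)
        have h2 : ψ w - r • w ∈ x • (⊤ : Submodule R W) := by
          rw [← Submodule.ker_mkQ (x • (⊤ : Submodule R W)), LinearMap.mem_ker, map_sub, map_smul]
          rw [sub_eq_zero]
          exact this
        obtain ⟨v, -, hv⟩ := (Submodule.mem_smul_pointwise_iff_exists _ _ _).mp h2
        exact ⟨v, hv⟩
      choose v hv using hdiv
      let χ : W →ₗ[R] W :=
        { toFun := v
          map_add' := fun a b ↦ reg.1 (by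
            simp only [smul_add, hv, map_add]
            abel)
          map_smul' := fun c a ↦ reg.1 (by
            simp only [RingHom.id_apply, hv, map_smul, smul_comm x c, smul_sub, smul_comm r c]) }
      refine Submodule.mem_sup.mpr ⟨r • LinearMap.id,
        Submodule.smul_mem _ _ (Submodule.mem_span_singleton_self _), x • χ,
        Submodule.smul_mem_smul (Ideal.mem_span_singleton_self x) trivial, ?_⟩
      ext w
      simp [χ, hv]
    have htop := Submodule.le_of_le_smul_of_le_jacobson_bot (I := Ideal.span {x})
      Module.Finite.fg_top (by
        rw [IsLocalRing.jacobson_eq_maximalIdeal _ bot_ne_top]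
        simpa [Ideal.span_le] using mem.1) hsup
    obtain ⟨r, hr⟩ := Submodule.mem_span_singleton.mp (htop (Submodule.mem_top (x := φ)))
    exact ⟨r, hr.symm⟩

/-- The homothety map `R → End(W)` is bijective if `R` and `W` have a common regular sequence `rs`
with `R ⧸ (rs)` of finite length and `Hom(-, W ⧸ (rs)W)` preserves the lengths of the
finite length modules killed by `rs`. -/
lemma bijective_lsmul_of_length_hom {W : Type u} [AddCommGroup W] [Module R W]
    [Module.Finite R W] {rs : List R} (mem : ∀ r ∈ rs, r ∈ IsLocalRing.maximalIdeal R)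
    (reg : IsWeaklyRegular W rs) (hfin : IsFiniteLength R (R ⧸ Ideal.ofList rs))
    (hlen : ∀ (L : Type u) [AddCommGroup L] [Module R L], IsFiniteLength R L →
      Ideal.ofList rs ≤ Module.annihilator R L →
      Module.length R (L →ₗ[R] W ⧸ Ideal.ofList rs • (⊤ : Submodule R W)) = Module.length R L) :
    Function.Bijective (LinearMap.lsmul R W) := by
  set I := Ideal.ofList rs
  set V := W ⧸ I • (⊤ : Submodule R W)
  have hIV : I ≤ Module.annihilator R V := by
    intro a ha
    rw [Module.mem_annihilator]
    intro v
    obtain ⟨w, rfl⟩ := Submodule.mkQ_surjective _ v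
    rw [← map_smul]
    exact (Submodule.Quotient.mk_eq_zero _).mpr (Submodule.smul_mem_smul ha trivial)
  -- Evaluation at `1` identifies `Hom(R ⧸ J, V)` with `V`. Comparing `J = I` with `J = Ann V`
  -- forces `Ann V = I`.
  have hom_eq (J : Ideal R) (hIJ : I ≤ J) (hJ : J ≤ Module.annihilator R V) :
      Module.length R (R ⧸ J) = Module.length R V := by
    rw [← hlen (R ⧸ J) (hfin.of_surjective (f := Submodule.factor hIJ)
      (Submodule.factor_surjective hIJ)) (hIJ.trans (Ideal.annihilator_quotient).ge)]
    refine (LinearEquiv.ofBijective (LinearMap.applyₗ (Ideal.Quotient.mk J 1)) ⟨?_, ?_⟩).length_eq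
    · intro f g hfg
      refine Submodule.linearMap_qext _ (LinearMap.ext_ring ?_)
      exact hfg
    · intro v
      exact ⟨J.liftQ (LinearMap.toSpanSingleton R V v) fun j hj ↦ by
        simpa using Module.mem_annihilator.mp (hJ hj) v, one_smul R v⟩
  have hV := hom_eq I le_rfl hIV
  have hVtop : Module.length R V ≠ ⊤ := hV ▸ Module.length_ne_top_iff.mpr hfin
  have hVfin : IsFiniteLength R V := Module.length_ne_top_iff.mp hVtop
  have hann : Module.annihilator R V ≤ I := by
    have hinj := injective_of_surjective_of_length_eq (Submodule.factor hIV)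
      (Submodule.factor_surjective hIV) (hV ▸ hVtop) (hV.trans (hom_eq _ hIV le_rfl).symm)
    intro a ha
    rw [← Ideal.Quotient.eq_zero_iff_mem]
    apply hinj
    rw [map_zero]
    exact Ideal.Quotient.eq_zero_iff_mem.mpr ha
  constructor
  · rw [← LinearMap.ker_eq_bot, eq_bot_iff]
    refine le_trans ?_ (annihilator_le_of_isWeaklyRegular mem reg bot_le (by simpa using hann))
    intro a ha
    rw [Module.mem_annihilator]
    exact fun w ↦ LinearMap.congr_fun ha w
  -- `R ⧸ I` embeds in `End(V)`, and both have the finite length of `V`; so every endomorphism of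
  -- `V` is a homothety.
  · let h : (R ⧸ I) →ₗ[R] (V →ₗ[R] V) := I.liftQ (LinearMap.lsmul R V) fun a ha ↦ by
      exact LinearMap.ext fun v ↦ Module.mem_annihilator.mp (hIV ha) v
    have hh : Function.Injective h := by
      rw [injective_iff_map_eq_zero]
      intro a ha
      obtain ⟨a, rfl⟩ := Ideal.Quotient.mk_surjective a
      rw [Ideal.Quotient.eq_zero_iff_mem]
      exact hann (Module.mem_annihilator.mpr fun v ↦ LinearMap.congr_fun ha v)
    have hs := surjective_of_injective_of_length_eq h hh (hV ▸ hVtop)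
      (hV.trans (hlen V hVfin hIV).symm)
    intro φ
    obtain ⟨r, hr⟩ := exists_smul_eq_of_isWeaklyRegular mem reg (fun ψ ↦ by
      obtain ⟨a, rfl⟩ := hs ψ
      obtain ⟨a, rfl⟩ := Ideal.Quotient.mk_surjective a
      exact ⟨a, rfl⟩) φ
    exact ⟨r, hr.symm⟩

end Endomorphisms

/-! ### Complexes of `Hom(-, Y)`-acyclic modules. -/

section Acyclic

variable {R : Type u} [CommRing R]

/-- Tensoring with a projective module preserves `Hom(-, Y)`-acyclicity. -/
lemma subsingleton_ext_projective_tensor {P C Y : Type u} [AddCommGroup P] [Module R P]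
    [Module.Projective R P] [AddCommGroup C] [Module R C] [AddCommGroup Y] [Module R Y]
    (hC : ∀ i, 1 ≤ i → Subsingleton (ExtModule R i C Y)) {i : ℕ} (hi : 1 ≤ i) :
    Subsingleton (ExtModule R i (P ⊗[R] C) Y) := by
  induction i, hi using Nat.le_induction generalizing Y with
  | base =>
    obtain ⟨⟨J, hJ, ι, hι⟩⟩ := EnoughInjectives.presentation (ModuleCat.of R Y)
    have hJ' : Injective (ModuleCat.of R J) := hJ
    have hinj : Function.Injective ι.hom := (ModuleCat.mono_iff_injective ι).mp hι
    have hex : Function.Exact ι.hom ι.hom.range.mkQ := ι.hom.exact_map_mkQ_range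
    have hsurj := Submodule.mkQ_surjective ι.hom.range
    refine subsingleton_ext_one_of_lift hinj hex hsurj (subsingleton_ext_of_injective le_rfl)
      fun φ ↦ ?_
    -- Since `Ext¹(C, Y) = 0`, the map `Hom(C, J) → Hom(C, J ⧸ Y)` is onto; projectivity of `P`
    -- lifts the curried map along it.
    have hs : Function.Surjective (LinearMap.llcomp R C J (J ⧸ ι.hom.range) ι.hom.range.mkQ) :=
      fun ψ ↦ exists_lift hinj hex hsurj (hC 1 le_rfl) ψ
    obtain ⟨ψ, hψ⟩ := Module.projective_lifting_property _ (TensorProduct.curry φ) hs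
    refine ⟨TensorProduct.lift ψ, TensorProduct.ext' fun p c ↦ ?_⟩
    simpa using LinearMap.congr_fun (LinearMap.congr_fun hψ p) c
  | succ i hi ih =>
    obtain ⟨⟨J, hJ, ι, hι⟩⟩ := EnoughInjectives.presentation (ModuleCat.of R Y)
    have hJ' : Injective (ModuleCat.of R J) := hJ
    have hinj : Function.Injective ι.hom := (ModuleCat.mono_iff_injective ι).mp hι
    have hex : Function.Exact ι.hom ι.hom.range.mkQ := ι.hom.exact_map_mkQ_range
    have hsurj := Submodule.mkQ_surjective ι.hom.range
    -- Dimension shift: `J ⧸ Y` inherits the hypothesis on `Y`, so the induction must vary `Y`.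
    exact subsingleton_ext_succ_of_right hinj hex hsurj
      (subsingleton_ext_of_injective (by omega))
      (ih fun j hj ↦ subsingleton_ext_of_left hinj hex hsurj
        (subsingleton_ext_of_injective hj) (hC (j + 1) (by omega)))

/-- Let `X` be a chain complex of `Hom(-, Y)`-acyclic modules that is exact in degrees `1, …, n`
and such that `H₀(X)` is `Hom(-, Y)`-acyclic. Then every `j`-cocycle with values in `Y` with
`1 ≤ j ≤ n` is a coboundary. -/
lemma exists_extension_of_acyclic (X : ℕ → Type u) [∀ j, AddCommGroup (X j)] [∀ j, Module R (X j)]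
    (d : ∀ j, X (j + 1) →ₗ[R] X j) {Y : Type u} [AddCommGroup Y] [Module R Y]
    (hX : ∀ j i, 1 ≤ i → Subsingleton (ExtModule R i (X j) Y))
    (h0 : ∀ i, 1 ≤ i → Subsingleton (ExtModule R i (X 0 ⧸ (d 0).range) Y)) {n : ℕ}
    (hd : ∀ j, j < n → Function.Exact (d (j + 1)) (d j)) {j : ℕ} (hj : j < n)
    (φ : X (j + 1) →ₗ[R] Y) (hφ : φ ∘ₗ d (j + 1) = 0) :
    ∃ ψ : X j →ₗ[R] Y, ψ ∘ₗ d j = φ := by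
  -- With `Q j = coker (d j)`, exactness gives `0 → Q (j + 1) → X j → Q j → 0`. Acyclicity climbs
  -- from `Q 0`, and a cocycle on `X (j + 1)` is a map on `Q (j + 1)`, which extends to `X j`.
  let f (j : ℕ) (hj : j < n) : (X (j + 1) ⧸ (d (j + 1)).range) →ₗ[R] X j :=
    (d (j + 1)).range.liftQ (d j) (by
      rintro _ ⟨x, rfl⟩
      exact (hd j hj).apply_apply_eq_zero x)
  have hf (j : ℕ) (hj : j < n) : Function.Injective (f j hj) := by
    rw [← LinearMap.ker_eq_bot]
    exact Submodule.ker_liftQ_eq_bot _ _ _ (hd j hj).linearMap_ker_eq.le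
  have hr (j : ℕ) (hj : j < n) : (f j hj).range = (d j).range := Submodule.range_liftQ _ _ _
  have hex (j : ℕ) (hj : j < n) : Function.Exact (f j hj) (d j).range.mkQ := by
    rw [LinearMap.exact_iff, hr j hj, Submodule.ker_mkQ]
  have hQ (j : ℕ) (hj : j < n) (i : ℕ) (hi : 1 ≤ i) :
      Subsingleton (ExtModule R i (X j ⧸ (d j).range) Y) := by
    induction j generalizing i with
    | zero => exact h0 i hi
    | succ j ih =>
      have hj' : j < n := by omega
      exact subsingleton_ext_left (hf j hj') (hex j hj')
        (Submodule.mkQ_surjective _) (hX j i hi) (ih hj' (i + 1) (by omega))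
  obtain ⟨ψ, hψ⟩ := exists_extension (hf j hj) (hex j hj) (Submodule.mkQ_surjective _)
    (hQ j hj 1 le_rfl) ((d (j + 1)).range.liftQ φ (by
      rintro _ ⟨x, rfl⟩
      exact LinearMap.congr_fun hφ x))
  refine ⟨ψ, LinearMap.ext fun x ↦ ?_⟩
  exact LinearMap.congr_fun hψ (Submodule.Quotient.mk x)

end Acyclic

/-! ### Reflexivity with respect to `ω`. -/

section Biduality

variable {R : Type u} [CommRing R]

/-- The evaluation map `N → Hom(Hom(N, ω), ω)`. -/
noncomputable abbrev evaluation (R : Type u) [CommRing R] (ω : Type u) [AddCommGroup ω]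
    [Module R ω] (N : Type u) [AddCommGroup N] [Module R N] :
    N →ₗ[R] CanonicalDual R ω (CanonicalDual R ω N) :=
  LinearMap.applyₗ

variable {ω : Type u} [AddCommGroup ω] [Module R ω]

/-- The dual of `Rⁿ` is `ωⁿ`, so its bidual is `End(ω)ⁿ = Rⁿ`: restricting a functional to the
`i`-th copy of `ω` gives the homothety by the `i`-th coordinate. -/
lemma bijective_evaluation_free (hω : Function.Bijective (LinearMap.lsmul R ω)) (n : ℕ) :
    Function.Bijective (evaluation R ω (Fin n → R)) := by
  constructor
  · rw [injective_iff_map_eq_zero]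
    intro x hx
    funext i
    apply hω.1
    rw [Pi.zero_apply, map_zero]
    ext w
    simpa using LinearMap.congr_fun hx ((LinearMap.proj i).smulRight w)
  · intro φ
    have hr (i : Fin n) : ∃ r : R, ∀ w : ω,
        φ ((LinearMap.proj i : (Fin n → R) →ₗ[R] R).smulRight w) = r • w := by
      obtain ⟨r, hr⟩ := hω.2
        (φ ∘ₗ LinearMap.smulRightₗ (LinearMap.proj i : (Fin n → R) →ₗ[R] R))
      exact ⟨r, fun w ↦ (LinearMap.congr_fun hr w).symm⟩
    choose r hr using hr
    refine ⟨r, LinearMap.ext fun f ↦ ?_⟩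
    have hf : f = ∑ i, (LinearMap.proj i : (Fin n → R) →ₗ[R] R).smulRight
        (f fun j ↦ if i = j then 1 else 0) := by
      refine LinearMap.ext fun x ↦ ?_
      rw [LinearMap.pi_apply_eq_sum_univ f x]
      simp
    conv_rhs => rw [hf]
    rw [map_sum]
    simp only [hr]
    exact LinearMap.pi_apply_eq_sum_univ f r

lemma subsingleton_ext_dual_free
    (hω : ∀ i, 1 ≤ i → Subsingleton (ExtModule R i ω ω)) (n : ℕ) {i : ℕ} (hi : 1 ≤ i) :
    Subsingleton (ExtModule R i (CanonicalDual R ω (Fin n → R)) ω) :=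
  subsingleton_ext_congr_left (dualTensorHomEquiv R (Fin n → R) ω) i
    (subsingleton_ext_projective_tensor hω hi)

section ShortExact

variable {A B C : Type u} [AddCommGroup A] [Module R A] [AddCommGroup B] [Module R B]
  [AddCommGroup C] [Module R C] {f : A →ₗ[R] B} {g : B →ₗ[R] C}

lemma dual_shortExact (hf : Function.Injective f)
    (hfg : Function.Exact f g) (hg : Function.Surjective g)
    (hC : Subsingleton (ExtModule R 1 C ω)) :
    Function.Injective (LinearMap.lcomp R ω g) ∧
      Function.Exact (LinearMap.lcomp R ω g) (LinearMap.lcomp R ω f) ∧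
      Function.Surjective (LinearMap.lcomp R ω f) :=
  ⟨LinearMap.lcomp_injective_of_surjective g hg,
    LinearMap.exact_lcomp_of_exact_of_surjective ω hfg hg,
    fun φ ↦ exists_extension hf hfg hg hC φ⟩

end ShortExact

/-- The syzygy inherits the hypothesis on `N`, so arguments can be iterated along a free resolution.
-/
lemma exists_free_cover (N : Type u) [AddCommGroup N] [Module R N] [Module.Finite R N]
    (hN : ∀ i, 1 ≤ i → Subsingleton (ExtModule R i N ω)) :
    ∃ (n : ℕ) (g : (Fin n → R) →ₗ[R] N), Function.Surjective g ∧
      ∀ i, 1 ≤ i → Subsingleton (ExtModule R i g.ker ω) := by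
  obtain ⟨n, g, hg⟩ := Module.Finite.exists_fin' R N
  exact ⟨n, g, hg, fun i hi ↦ subsingleton_ext_left g.ker.subtype_injective
    g.exact_subtype_ker_map hg (subsingleton_ext_of_projective hi) (hN (i + 1) (by omega))⟩

variable [IsNoetherianRing R]

/-- Dualizing `0 → K → F → N → 0` stays exact as `Ext¹(N, ω) = 0`, and `F^∨` is acyclic. So the
claim for `N` in degree `i` follows from that for `K` in degree `i + 1`, until the degree exceeds
the injective dimension. -/
theorem subsingleton_ext_dual (hω : ∀ i, 1 ≤ i → Subsingleton (ExtModule R i ω ω))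
    (hid : ∃ D : ℕ, HasInjectiveDimensionLE (ModuleCat.of R ω) D)
    {N : Type u} [AddCommGroup N] [Module R N] [Module.Finite R N]
    (hN : ∀ i, 1 ≤ i → Subsingleton (ExtModule R i N ω)) {i : ℕ} (hi : 1 ≤ i) :
    Subsingleton (ExtModule R i (CanonicalDual R ω N) ω) := by
  obtain ⟨D, hD⟩ := hid
  obtain ⟨m, hm⟩ : ∃ m, D < i + m := ⟨D + 1, by omega⟩
  induction m generalizing i N with
  | zero => exact HasInjectiveDimensionLT.subsingleton (ModuleCat.of R ω) (D + 1) i (by omega) _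
  | succ m ih =>
    obtain ⟨n, g, hg, hK⟩ := exists_free_cover N hN
    obtain ⟨h1, h2, h3⟩ := dual_shortExact g.ker.subtype_injective g.exact_subtype_ker_map hg
      (hN 1 le_rfl)
    exact subsingleton_ext_left h1 h2 h3 (subsingleton_ext_dual_free hω n hi)
      (ih hK (by omega) (by omega))

/-- Functionals on `N^∨` extend to `F^∨` since `Ext¹(K^∨, ω) = 0`, and `F` is reflexive; this gives
surjectivity. Injectivity for `N` uses surjectivity for the syzygy `K`. -/
theorem bijective_evaluation (hω : ∀ i, 1 ≤ i → Subsingleton (ExtModule R i ω ω))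
    (hid : ∃ D : ℕ, HasInjectiveDimensionLE (ModuleCat.of R ω) D)
    (hend : Function.Bijective (LinearMap.lsmul R ω))
    {N : Type u} [AddCommGroup N] [Module R N] [Module.Finite R N]
    (hN : ∀ i, 1 ≤ i → Subsingleton (ExtModule R i N ω)) :
    Function.Bijective (evaluation R ω N) := by
  have hsurj {N : Type u} [AddCommGroup N] [Module R N] [Module.Finite R N]
      (hN : ∀ i, 1 ≤ i → Subsingleton (ExtModule R i N ω)) :
      Function.Surjective (evaluation R ω N) := by
    intro φ
    obtain ⟨n, g, hg, hK⟩ := exists_free_cover N hN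
    obtain ⟨h1, h2, h3⟩ := dual_shortExact g.ker.subtype_injective g.exact_subtype_ker_map hg
      (hN 1 le_rfl)
    obtain ⟨ψ, hψ⟩ := exists_extension h1 h2 h3 (subsingleton_ext_dual hω hid hK le_rfl) φ
    obtain ⟨y, rfl⟩ := (bijective_evaluation_free hend n).2 ψ
    exact ⟨g y, hψ⟩
  refine ⟨?_, hsurj hN⟩
  rw [injective_iff_map_eq_zero]
  intro x hx
  obtain ⟨n, g, hg, hK⟩ := exists_free_cover N hN
  obtain ⟨y, rfl⟩ := hg x
  obtain ⟨h1, h2, h3⟩ := dual_shortExact g.ker.subtype_injective g.exact_subtype_ker_map hg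
    (hN 1 le_rfl)
  -- Evaluation at `y` vanishes on `N^∨`, so it factors through `K^∨` and is evaluation at some `z`
  -- in `K`; hence `y = z` dies in `N`.
  obtain ⟨φ, hφ⟩ := (LinearMap.exact_lcomp_of_exact_of_surjective ω h2 h3
    (evaluation R ω _ y)).mp (LinearMap.ext fun ψ ↦ LinearMap.congr_fun hx ψ)
  obtain ⟨z, rfl⟩ := hsurj hK φ
  have : y = z := (bijective_evaluation_free hend n).1 hφ.symm
  rw [this]
  exact z.2

end Biduality

/-! ### From vanishing of Tor to vanishing of Ext. -/

section Tor

variable {R : Type u} [CommRing R] {M C : Type u} [AddCommGroup M] [Module R M]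
  [AddCommGroup C] [Module R C]

lemma exact_rTensor_of_subsingleton_tor (P : ProjectiveResolution (ModuleCat.of R M)) {j : ℕ}
    (h : Subsingleton (TorModule R (j + 1) M C)) :
    Function.Exact ((P.complex.d (j + 2) (j + 1)).hom.rTensor C)
      ((P.complex.d (j + 1) j).hom.rTensor C) := by
  let F := (MonoidalCategory.tensoringRight (ModuleCat.{u} R)).obj (ModuleCat.of R C)
  have h0 := (ModuleCat.isZero_of_iff_subsingleton.mpr h).of_iso
    (P.isoLeftDerivedObj F (j + 1)).symm
  have h1 : HomologicalComplex.ExactAt ((F.mapHomologicalComplex _).obj P.complex) (j + 1) :=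
    (HomologicalComplex.exactAt_iff_isZero_homology _ _).mpr h0
  rw [HomologicalComplex.exactAt_iff' _ (j + 2) (j + 1) j (by simp) (by simp)] at h1
  exact (ShortComplex.ShortExact.moduleCat_exact_iff_function_exact _).mp h1

lemma nonempty_rTensor_quotient_equiv (P : ProjectiveResolution (ModuleCat.of R M)) :
    Nonempty (((P.complex.X 0 ⊗[R] C) ⧸ ((P.complex.d 1 0).hom.rTensor C).range) ≃ₗ[R]
      M ⊗[R] C) := by
  let π : P.complex.X 0 →ₗ[R] M := (P.π.f 0).hom
  have hπ : Function.Surjective π := (ModuleCat.epi_iff_surjective (P.π.f 0)).mp inferInstance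
  have hex : Function.Exact (P.complex.d 1 0).hom π :=
    (ShortComplex.ShortExact.moduleCat_exact_iff_function_exact _).mp P.exact₀
  exact ⟨(rTensor_exact C hex hπ).linearEquivOfSurjective (LinearMap.rTensor_surjective C hπ)⟩

/-- If `C` and `M ⊗ C` are `Hom(-, ω)`-acyclic and `Tor_j(M, C) = 0` for `1 ≤ j ≤ n`, then
`Ext^j(M, Hom(C, ω)) = 0` for `1 ≤ j ≤ n`. -/
theorem subsingleton_ext_of_subsingleton_tor {ω N : Type u} [AddCommGroup ω] [Module R ω]
    [AddCommGroup N] [Module R N] (e : N ≃ₗ[R] (C →ₗ[R] ω))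
    (hC : ∀ i, 1 ≤ i → Subsingleton (ExtModule R i C ω))
    (hMC : ∀ i, 1 ≤ i → Subsingleton (ExtModule R i (M ⊗[R] C) ω)) {n : ℕ}
    (hTor : ∀ j, 1 ≤ j → j ≤ n → Subsingleton (TorModule R j M C)) {j : ℕ} (hj : 1 ≤ j)
    (hjn : j ≤ n) : Subsingleton (ExtModule R j M N) := by
  obtain ⟨j, rfl⟩ := Nat.exists_eq_add_of_le' hj
  let P := projectiveResolution (ModuleCat.of R M)
  refine subsingleton_of_forall_eq 0 fun x ↦ ?_
  -- The class is given by a cocycle `P_{j+1} → N`; it is zero once the cocycle factors through the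
  -- differential to `P_j`. Adjunction turns this into a factorization for `P ⊗ C` with values in
  -- `ω`.
  obtain ⟨f, hf, rfl⟩ := P.extMk_surjective x (j + 2) rfl
  rw [P.extMk_eq_zero_iff f _ _ hf j rfl]
  have hproj (i : ℕ) : Module.Projective R (P.complex.X i) :=
    (IsProjective.iff_projective _).mpr (P.projective i)
  obtain ⟨e₀⟩ := nonempty_rTensor_quotient_equiv (C := C) P
  obtain ⟨ψ, hψ⟩ := exists_extension_of_acyclic (fun i ↦ P.complex.X i ⊗[R] C)
    (fun i ↦ (P.complex.d (i + 1) i).hom.rTensor C) (Y := ω)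
    (fun i k hk ↦ subsingleton_ext_projective_tensor hC hk)
    (fun i hi ↦ subsingleton_ext_congr_left e₀.symm i (hMC i hi))
    (fun i hi ↦ exact_rTensor_of_subsingleton_tor P (hTor (i + 1) (by omega) hi))
    (show j < n from hjn) (TensorProduct.lift (e.toLinearMap ∘ₗ f.hom)) (by
      refine TensorProduct.ext' fun p c ↦ ?_
      have := congrArg (fun g ↦ g.hom p) hf
      simp at this
      simp [this])
  refine ⟨ModuleCat.ofHom (e.symm.toLinearMap ∘ₗ TensorProduct.curry ψ), ?_⟩
  ext p
  apply e.injective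
  ext c
  simpa using LinearMap.congr_fun hψ (p ⊗ₜ c)

end Tor

/-! ### The canonical module: acyclicity and endomorphisms. -/

section CanonicalModule

lemma exists_ringKrullDim_eq_natCast {R : Type u} [CommRing R] [FiniteRingKrullDim R] :
    ∃ d : ℕ, ringKrullDim R = d := by
  obtain ⟨d, hd⟩ := WithBot.ne_bot_iff_exists.mp (ringKrullDim_ne_bot (R := R))
  have htop : d ≠ ⊤ := fun h ↦ ringKrullDim_ne_top (R := R) (by rw [← hd, h]; rfl)
  lift d to ℕ using htop
  exact ⟨d, hd.symm⟩

variable {R : Type u} [CommRing R] [IsLocalRing R] {ω : Type u} [AddCommGroup ω] [Module R ω]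

lemma IsCohenMacaulayLocalRing.isMaximalCohenMacaulay (hR : IsCohenMacaulayLocalRing R) :
    IsMaximalCohenMacaulay R R :=
  ⟨inferInstance, hR.depth_eq⟩

theorem IsCanonicalModule.subsingleton_ext (hR : IsCohenMacaulayLocalRing R)
    (hω : IsCanonicalModule R ω) {X : Type u} [AddCommGroup X] [Module R X]
    (hX : IsMaximalCohenMacaulay R X) {i : ℕ} (hi : 1 ≤ i) :
    Subsingleton (ExtModule R i X ω) := by
  have := hR.noetherian
  have := hω.isMaximalCohenMacaulay.finite
  have := hX.finite
  obtain ⟨d, hd⟩ : ∃ d : ℕ, ringKrullDim R = d := exists_ringKrullDim_eq_natCast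
  obtain ⟨rs, rfl, mem, reg⟩ := hR.isMaximalCohenMacaulay.exists_isRegular hd
  obtain ⟨ts, ht, mem', reg'⟩ := hX.exists_isRegular hd
  exact subsingleton_ext_of_isWeaklyRegular mem' reg'.toIsWeaklyRegular
    (fun Z _ _ _ i hi ↦ subsingleton_ext_of_length_lt mem reg
      (isFiniteLength_quotient_of_isRegular reg hd) hω.finite_injectiveDimension hi) (by omega)

/-- Type one and finite injective dimension make `Ext^d(-, ω)`, `d = dim R`, preserve finite
lengths. On modules killed by a common regular sequence `ts` it is `Hom(-, ω ⧸ (ts)ω)`, as the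
length criterion requires. -/
theorem IsCanonicalModule.bijective_lsmul (hR : IsCohenMacaulayLocalRing R)
    (hω : IsCanonicalModule R ω) : Function.Bijective (LinearMap.lsmul R ω) := by
  have := hR.noetherian
  have := hω.isMaximalCohenMacaulay.finite
  have := hω.isMaximalCohenMacaulay.nontrivial
  obtain ⟨d, hd⟩ : ∃ d : ℕ, ringKrullDim R = d := exists_ringKrullDim_eq_natCast
  obtain ⟨rs, rfl, mem, reg⟩ := hR.isMaximalCohenMacaulay.exists_isRegular hd
  obtain ⟨rs', hl', mem', reg'⟩ := hω.isMaximalCohenMacaulay.exists_isRegular hd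
  obtain ⟨ts, hl, memt, regR, regω⟩ := exists_isRegular_common mem reg mem' reg' hl'.symm
  rw [← hl] at hd
  have hfin := isFiniteLength_quotient_of_isRegular regR hd
  -- The depth of `ω` is finite and equal to `dim R`, so `toNat` in `moduleType` gives the true
  -- degree.
  have htype : Module.length R (ExtModule R ts.length (IsLocalRing.ResidueField R) ω) = 1 := by
    have h1 := hω.type_eq_one
    have h2 := hω.isMaximalCohenMacaulay.depth_eq
    have h3 : depth R ω = ts.length := by
      rw [hd] at h2
      exact_mod_cast h2
    rw [moduleType, h3, ENat.toNat_natCast] at h1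
    exact h1
  refine bijective_lsmul_of_length_hom memt regω.toIsWeaklyRegular hfin fun L _ _ hL hann ↦ ?_
  obtain ⟨e⟩ := nonempty_hom_linearEquiv_ext memt regω hL
    fun r hr ↦ hann (Ideal.subset_span hr)
  rw [e.length_eq]
  exact length_ext_eq_length memt regω htype (fun Z _ _ _ i hi ↦
    subsingleton_ext_of_length_lt memt regR hfin hω.finite_injectiveDimension hi) hL

end CanonicalModule

end CohenMacaulay

theorem mainTheorem12 (R : Type u) [CommRing R] [IsLocalRing R]
    (hR : CohenMacaulay.IsCohenMacaulayLocalRing R)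
    (ω : Type u) [AddCommGroup ω] [Module R ω] (hω : CohenMacaulay.IsCanonicalModule R ω)
    (M : Type u) [AddCommGroup M] [Module R M] [Module.Finite R M]
    (N : Type u) [AddCommGroup N] [Module R N] [Module.Finite R N]
    (hN : CohenMacaulay.IsMaximalCohenMacaulay R N)
    (hMN : CohenMacaulay.IsMaximalCohenMacaulay R (M ⊗[R] CohenMacaulay.CanonicalDual R ω N)) :
    (∀ n : ℕ, 1 ≤ n →
      (∀ j : ℕ, 1 ≤ j → j ≤ n →
        Subsingleton (CohenMacaulay.TorModule R j M (CohenMacaulay.CanonicalDual R ω N))) →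
      ∀ j : ℕ, 1 ≤ j → j ≤ n → Subsingleton (CohenMacaulay.ExtModule R j M N)) ∧
    (CohenMacaulay.TorIndependent R M (CohenMacaulay.CanonicalDual R ω N) →
      ∀ j : ℕ, 1 ≤ j → Subsingleton (CohenMacaulay.ExtModule R j M N)) := by
  have := hR.noetherian
  have hωω (i : ℕ) (hi : 1 ≤ i) := hω.subsingleton_ext hR hω.isMaximalCohenMacaulay hi
  have hNω (i : ℕ) (hi : 1 ≤ i) := hω.subsingleton_ext hR hN hi
  have key (n : ℕ) (hTor : ∀ j : ℕ, 1 ≤ j → j ≤ n →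
      Subsingleton (CohenMacaulay.TorModule R j M (CohenMacaulay.CanonicalDual R ω N)))
      (j : ℕ) (hj : 1 ≤ j) (hjn : j ≤ n) : Subsingleton (CohenMacaulay.ExtModule R j M N) :=
    CohenMacaulay.subsingleton_ext_of_subsingleton_tor
      (LinearEquiv.ofBijective _ (CohenMacaulay.bijective_evaluation hωω
        hω.finite_injectiveDimension (hω.bijective_lsmul hR) hNω))
      (fun i hi ↦ CohenMacaulay.subsingleton_ext_dual hωω hω.finite_injectiveDimension hNω hi)
      (fun i hi ↦ hω.subsingleton_ext hR hMN hi) hTor hj hjn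
  exact ⟨fun n _ ↦ key n, fun h j hj ↦ key j (fun i hi _ ↦ h i hi) j hj le_rfl⟩
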